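/- Let $n\ge 1$, let $\mathbb{B}^n$ be the open Euclidean unit ball of $\mathbb{C}^n\cong\mathbb{R}^{2n}$, let $\mathbb{D}=\mathbb{B}^1$, and let $\Delta=\sum_{j=1}^n(\partial^2/\partial x_j^2+\partial^2/\partial y_j^2)$. Let $\varphi:\overline{\mathbb{B}^n}\to\mathbb{C}$ be holomorphic in $\mathbb{B}^n$ and continuous on $\overline{\mathbb{B}^n}$, with $\varphi(0)=0$ and $\sup_{\zeta\in\partial\mathbb{B}^n}|\varphi(\zeta)|\le 1$. Let $g_1\in C(\overline{\mathbb{B}^n})$ be complex-valued, and let $f\in C^2(\mathbb{B}^n)\cap C(\overline{\mathbb{B}^n})$ be complex-valued and satisfy $\Delta f=g_1$ in $\mathbb{B}^n$ and $f=\varphi$ on $\partial\mathbb{B}^n$. For $\eta\in\partial\mathbb{B}^n$ put $$\lambda_{\varphi,\eta}(0)=\begin{cases}\dfrac{|D^2\varphi(0)(\eta,\eta)|}{2(1-|D\varphi(0)\eta|^2)}, & |D\varphi(0)\eta|<1,\\[2mm] 1, & |D\varphi(0)\eta|=1,\end{cases}\qquad \|g_1\|_\infty=\sup_{z\in\mathbb{B}^n}|g_1(z)|.$$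 If $\eta\in\partial\mathbb{B}^n$ is such that $\lim_{r\to1^-}|f(r\eta)|=1$, then $$\liminf_{r\to1^-}\frac{|f(\eta)-f(r\eta)|}{1-r}\ \ge\ 1+\frac{2}{1+\lambda_{\varphi,\eta}(0)}\cdot\frac{1-|D\varphi(0)\eta|}{1+|D\varphi(0)\eta|}-\frac{\|g_1\|_\infty}{2n}\qquad(*)$$ (the left-hand side may be $+\infty$). Moreover, $(*)$ is sharp for each positive value of its right-hand side: for every $\eta\in\partial\mathbb{B}^n$ and all real numbers $\alpha,\beta\in[0,1]$ (with $\beta=1$ in case $\alpha=1$) and $s\ge0$ such that $$1+\frac{2}{1+\beta}\cdot\frac{1-\alpha}{1+\alpha}-\frac{s}{2n}>0,$$ there exist $\varphi$, $g_1$, $f$ satisfying all the hypotheses above (including $\lim_{r\to1^-}|f(r\eta)|=1$), with $\varphi(\mathbb{B}^n)\subset\mathbb{D}$, $|D\varphi(0)\eta|=\alpha$, $\lambda_{\varphi,\eta}(0)=\beta$ and $\|g_1\|_\infty=s$, for which equality holds in $(*)$. -/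

import Mathlib

open Filter Topology

noncomputable section

/-- The Euclidean space `ℂⁿ`. -/
abbrev Cn (n : ℕ) : Type := EuclideanSpace ℂ (Fin n)

/-- `|Dφ(0)η|`. -/
def firstOrder {n : ℕ} (φ : Cn n → ℂ) (η : Cn n) : ℝ :=
  ‖fderiv ℂ φ 0 η‖

/-- `λ_{φ,η}(0)`, which is `|D²φ(0)(η²)| / (2 (1 - |Dφ(0)η|²))` if `|Dφ(0)η| < 1`,
and `1` if `|Dφ(0)η| = 1`. -/
def lambdaZero {n : ℕ} (φ : Cn n → ℂ) (η : Cn n) : ℝ :=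
  if firstOrder φ η < 1 then
    ‖iteratedFDeriv ℂ 2 φ 0 ![η, η]‖ / (2 * (1 - firstOrder φ η ^ 2))
  else 1

/-- The supremum norm over the open unit ball. -/
def supNormBall {n : ℕ} (g : Cn n → ℂ) : ℝ :=
  ⨆ z : Metric.ball (0 : Cn n) 1, ‖g z‖

/-- The quantity `1 + 2 / (1 + b) * (1 - a) / (1 + a) - s / (2 n)`. -/
def hopfBound (n : ℕ) (a b s : ℝ) : ℝ :=
  1 + 2 / (1 + b) * ((1 - a) / (1 + a)) - s / (2 * n)

/-- Admissible boundary data: holomorphic in the open ball, continuous on the closed ball,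
vanishing at the origin, and of modulus at most one on the sphere. -/
structure IsHolomorphicDatum {n : ℕ} (φ : Cn n → ℂ) : Prop where
  holomorphic : DifferentiableOn ℂ φ (Metric.ball 0 1)
  continuousOn : ContinuousOn φ (Metric.closedBall 0 1)
  map_zero : φ 0 = 0
  norm_le_one : ∀ ζ ∈ Metric.sphere (0 : Cn n) 1, ‖φ ζ‖ ≤ 1

/-- `f` is a classical solution of the Dirichlet problem `Δf = g` in the unit ball, `f = φ` on the
unit sphere: it is `C²` in the open ball and attains its boundary values continuously. The
Laplacian is that of the underlying real Euclidean space `ℝ²ⁿ`. -/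
structure IsPoissonSolution {n : ℕ} (g φ f : Cn n → ℂ) : Prop where
  contDiffOn : ContDiffOn ℝ 2 f (Metric.ball 0 1)
  continuousOn : ContinuousOn f (Metric.closedBall 0 1)
  laplacian_eq : ∀ z ∈ Metric.ball (0 : Cn n) 1, Laplacian.laplacian f z = g z
  boundary_eq : ∀ ζ ∈ Metric.sphere (0 : Cn n) 1, f ζ = φ ζ

/-- `liminf_{r → 1⁻} |f(η) - f(rη)| / (1 - r)`, as an extended real number. -/
def radialLiminf {n : ℕ} (f : Cn n → ℂ) (η : Cn n) : EReal :=
  liminf (fun r : ℝ => ((‖f η - f (r • η)‖ / (1 - r) : ℝ) : EReal)) (𝓝[<] (1 : ℝ))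

end

/-!
A solution `f` of `Δ f = g` with boundary values `φ` splits as `f = φ + (f - φ)`, and the two parts
are estimated separately along the radius to `η`.

Since `φ` is harmonic (`ContDiffAt.laplacian_eq_zero_of_complex`), `Δ (f - φ) = g` and `f - φ`
vanishes on the sphere. As `Δ ‖z‖² = 4 n`, the maximum principle applied to real parts of rotations
of `f - φ` gives `‖f z - φ z‖ ≤ ‖g‖∞ (1 - ‖z‖²) / (4 n)` (`norm_le_of_norm_laplacian_le`), which
costs at most `‖g‖∞ / (2 n)` in the difference quotient at `η`. No Green function is needed.

On the complex line through `η`, `h ζ = φ (ζ η)` is a map of the disk fixing `0`. Dividing by `ζ`,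
moving the value at `0` to `0` by a disk automorphism and dividing by `ζ` again, three uses of the
Schwarz lemma give `|h r| ≤ r T_a (r T_b r)` (`norm_le_schwarzMajorant`), where
`T_a x = (x + a) / (1 + a x)`, `a = |h' 0|` and `b = λ`. The majorant equals `1` at `r = 1`, with
derivative `1 + 2 / (1 + b) * ((1 - a) / (1 + a))` there. Since `|f η| = 1`, these two estimates
give the lower bound (`hopfBound_le_radialLiminf`).

Both estimates are equalities for `φ z = H ⟪η, z⟫`, where `H w = w T_a (w T_b w)`, and
`f z = φ z + s (1 - ‖z‖²) / (4 n)`, which solves `Δ f = -s`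
(`exists_radialLiminf_eq_hopfBound`); the quotient `(f η - f (r η)) / (1 - r)` is then real and
tends to the bound, and positivity of the bound lets its absolute value have the same limit.

Mathlib derives smoothness of holomorphic functions on domains in `ℂ` only. In several variables
two derivatives are obtained here by applying the Schwarz lemma to increments (continuity of the
derivative) and by differentiating Cauchy integrals along complex lines
(`DifferentiableOn.contDiffOn_two_complex`).
-/

/-! ### Holomorphic maps of several variables are twice continuously differentiable -/

theorem norm_fderiv_le_of_forall_mem_ball {E F : Type*} [NormedAddCommGroup E] [NormedSpace ℂ E]
    [NormedAddCommGroup F] [NormedSpace ℂ F] {f : E → F} {c : E} {R M : ℝ} (hR : 0 < R)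
    (hd : DifferentiableOn ℂ f (Metric.ball c R)) (hM : ∀ z ∈ Metric.ball c R, ‖f z‖ ≤ M) :
    ‖fderiv ℂ f c‖ ≤ 2 * M / R := by
  refine Complex.norm_fderiv_le_div_of_mapsTo_ball hd (fun z hz => ?_) hR
  rw [mem_closedBall_iff_norm]
  calc ‖f z - f c‖ ≤ ‖f z‖ + ‖f c‖ := norm_sub_le _ _
    _ ≤ 2 * M := by linarith [hM z hz, hM c (Metric.mem_ball_self hR)]

/-- The derivative of a holomorphic map is even locally Lipschitz, by the Cauchy estimates for the
map and then for its increments. -/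
theorem DifferentiableOn.continuousOn_fderiv_complex {E F : Type*} [NormedAddCommGroup E]
    [NormedSpace ℂ E] [NormedAddCommGroup F] [NormedSpace ℂ F] {f : E → F} {U : Set E}
    (hf : DifferentiableOn ℂ f U) (hU : IsOpen U) : ContinuousOn (fderiv ℂ f) U := by
  intro z₀ hz₀
  refine ContinuousAt.continuousWithinAt ?_
  have hev : ∀ᶠ z in 𝓝 z₀, z ∈ U ∧ ‖f z‖ < ‖f z₀‖ + 1 :=
    (hU.eventually_mem hz₀).and
      ((hf.differentiableAt (hU.mem_nhds hz₀)).continuousAt.norm.eventually_lt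
        continuousAt_const (by simp))
  obtain ⟨ε, hε, hball⟩ := Metric.eventually_nhds_iff_ball.1 hev
  obtain ⟨R, rfl⟩ : ∃ R, ε = 2 * R := ⟨ε / 2, by ring⟩
  have hR : 0 < R := by linarith
  set L := 2 * (‖f z₀‖ + 1) / R
  have hdf : ∀ z ∈ Metric.ball z₀ R, ‖fderiv ℂ f z‖ ≤ L := by
    intro z hz
    have hsub : Metric.ball z R ⊆ Metric.ball z₀ (2 * R) :=
      Metric.ball_subset_ball' (by linarith [Metric.mem_ball.1 hz])
    exact norm_fderiv_le_of_forall_mem_ball hR (hf.mono fun w hw => (hball w (hsub hw)).1)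
      fun w hw => (hball w (hsub hw)).2.le
  have hdiff : ∀ z ∈ Metric.ball z₀ R, DifferentiableAt ℂ f z := fun z hz =>
    hf.differentiableAt (hU.mem_nhds (hball z (Metric.ball_subset_ball (by linarith) hz)).1)
  have hlip : ∀ z ∈ Metric.ball z₀ R, ∀ w ∈ Metric.ball z₀ R, ‖f w - f z‖ ≤ L * ‖w - z‖ :=
    fun z hz w hw => (convex_ball z₀ R).norm_image_sub_le_of_norm_fderiv_le (𝕜 := ℂ) hdiff hdf hz hw
  refine continuousAt_of_locally_lipschitz (r := R / 2) (by linarith) (2 * L / (R / 2))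
    fun z hz => ?_
  -- The derivative is estimated through the increment `w ↦ f (w + h) - f w`, which is
  -- holomorphic and of size `O(‖h‖)`.
  set h := z - z₀ with hh
  have hhR : ‖h‖ < R / 2 := by rwa [dist_eq_norm] at hz
  have hmem : ∀ w ∈ Metric.ball z₀ (R / 2), w + h ∈ Metric.ball z₀ R := by
    intro w hw
    rw [mem_ball_iff_norm] at hw ⊢
    calc ‖w + h - z₀‖ = ‖(w - z₀) + h‖ := by congr 1; abel
      _ ≤ ‖w - z₀‖ + ‖h‖ := norm_add_le _ _
      _ < R := by linarith
  have hmem' : ∀ w ∈ Metric.ball z₀ (R / 2), w ∈ Metric.ball z₀ R :=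
    fun w hw => Metric.ball_subset_ball (by linarith) hw
  have hd1 : ∀ w ∈ Metric.ball z₀ (R / 2), DifferentiableAt ℂ (fun w => f (w + h)) w :=
    fun w hw => (hdiff _ (hmem w hw)).comp w (differentiableAt_id.add_const h)
  have key := norm_fderiv_le_of_forall_mem_ball (f := fun w => f (w + h) - f w) (c := z₀)
    (R := R / 2) (M := L * ‖h‖) (by linarith)
    (fun w hw => ((hd1 w hw).sub (hdiff w (hmem' w hw))).differentiableWithinAt)
    (fun w hw => by simpa using hlip w (hmem' w hw) (w + h) (hmem w hw))
  have hz₀' : z₀ ∈ Metric.ball z₀ (R / 2) := Metric.mem_ball_self (by linarith)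
  rw [fderiv_fun_sub (hd1 _ hz₀') (hdiff _ (hmem' _ hz₀')), fderiv_comp_add_right,
    show z₀ + h = z by rw [hh]; abel] at key
  rw [dist_eq_norm, dist_eq_norm]
  calc _ ≤ 2 * (L * ‖h‖) / (R / 2) := key
    _ = _ := by ring

/-- The directional derivatives of a holomorphic map are holomorphic: they are Cauchy integrals
over circles in the given direction, which may be differentiated under the integral sign. -/
theorem DifferentiableOn.fderiv_apply_complex {E F : Type*} [NormedAddCommGroup E]
    [NormedSpace ℂ E] [NormedAddCommGroup F] [NormedSpace ℂ F] [CompleteSpace F] {f : E → F}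
    {U : Set E} (hf : DifferentiableOn ℂ f U) (hU : IsOpen U) (v : E) :
    DifferentiableOn ℂ (fun z => fderiv ℂ f z v) U := by
  intro z₀ hz₀
  refine DifferentiableAt.differentiableWithinAt ?_
  have hcont := hf.continuousOn_fderiv_complex hU
  have hev : ∀ᶠ z in 𝓝 z₀, z ∈ U ∧ ‖fderiv ℂ f z‖ < ‖fderiv ℂ f z₀‖ + 1 :=
    (hU.eventually_mem hz₀).and ((hcont.continuousAt (hU.mem_nhds hz₀)).norm.eventually_lt
      continuousAt_const (by simp))
  obtain ⟨ε, hε, hball⟩ := Metric.eventually_nhds_iff_ball.1 hev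
  obtain ⟨R, rfl⟩ : ∃ R, ε = 2 * R := ⟨ε / 2, by ring⟩
  have hR : 0 < R := by linarith
  set r := R / (‖v‖ + 1) with hr_def
  have hr : 0 < r := by positivity
  have hrv : r * ‖v‖ < R := by
    rw [hr_def, div_mul_eq_mul_div, div_lt_iff₀ (by positivity)]
    nlinarith [norm_nonneg v]
  have hmem : ∀ z ∈ Metric.ball z₀ R, ∀ ζ : ℂ, ‖ζ‖ ≤ r → z + ζ • v ∈ Metric.ball z₀ (2 * R) := by
    intro z hz ζ hζ
    rw [mem_ball_iff_norm] at hz ⊢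
    calc ‖z + ζ • v - z₀‖ = ‖(z - z₀) + ζ • v‖ := by congr 1; abel
      _ ≤ ‖z - z₀‖ + ‖ζ‖ * ‖v‖ := (norm_add_le _ _).trans (by rw [norm_smul])
      _ < 2 * R := by nlinarith [norm_nonneg v, mul_le_mul_of_nonneg_right hζ (norm_nonneg v)]
  have hdiff : ∀ z ∈ Metric.ball z₀ (2 * R), DifferentiableAt ℂ f z := fun z hz =>
    hf.differentiableAt (hU.mem_nhds (hball z hz).1)
  have hnorm : ∀ θ : ℝ, ‖circleMap 0 r θ‖ = r := fun θ => by
    rw [norm_circleMap_zero, abs_of_pos hr]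
  set c : ℝ → ℂ := fun θ => _root_.deriv (circleMap 0 r) θ * (1 / (circleMap 0 r θ - 0) ^ 2) with hc
  have hcc : Continuous c := by
    refine Continuous.mul ?_ (Continuous.div₀ continuous_const (by fun_prop) fun θ => ?_)
    · rw [show _root_.deriv (circleMap 0 r) = fun θ => circleMap 0 r θ * Complex.I from
        funext fun θ => deriv_circleMap 0 r θ]
      fun_prop
    · have := hnorm θ
      intro h0
      rw [sub_zero] at h0
      rw [pow_eq_zero_iff two_ne_zero] at h0
      rw [h0, norm_zero] at this
      exact hr.ne this
  have hline : ∀ z ∈ Metric.ball z₀ R, Continuous fun θ : ℝ => f (z + circleMap 0 r θ • v) := by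
    intro z hz
    refine continuous_iff_continuousAt.2 fun θ => ?_
    exact ContinuousAt.comp (g := f) (hdiff _ (hmem z hz _ (hnorm θ).le)).continuousAt (by fun_prop)
  have hcauchy : ∀ z ∈ Metric.ball z₀ R, fderiv ℂ f z v = (2 * (Real.pi : ℂ) * Complex.I)⁻¹ •
      ∫ θ in (0 : ℝ)..2 * Real.pi, c θ • f (z + circleMap 0 r θ • v) := by
    intro z hz
    have hd : DifferentiableOn ℂ (fun ζ : ℂ => f (z + ζ • v)) (Metric.closedBall 0 r) := by
      intro ζ hζ
      exact ((hdiff _ (hmem z hz ζ (by simpa using hζ))).comp ζ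
        (by fun_prop : DifferentiableAt ℂ (fun ζ : ℂ => z + ζ • v) ζ)).differentiableWithinAt
    have h1 := hd.deriv_eq_smul_circleIntegral hr
    have h2 : HasDerivAt (fun ζ : ℂ => f (z + ζ • v)) (fderiv ℂ f z v) 0 := by
      have h3 : HasDerivAt (fun ζ : ℂ => z + ζ • v) v 0 := by
        simpa using ((hasDerivAt_id (0 : ℂ)).smul_const v).const_add z
      have h4 := hdiff _ (hmem z hz 0 (by simpa using hr.le))
      have h5 := h4.hasFDerivAt.comp_hasDerivAt (0 : ℂ) h3
      simpa [Function.comp_def] using h5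
    rw [h2.deriv] at h1
    rw [eq_inv_smul_iff₀ (by simp [Real.pi_ne_zero]), ← h1, circleIntegral]
    simp only [hc, smul_smul]
  have hcongr : (fun z => fderiv ℂ f z v) =ᶠ[𝓝 z₀] fun z => (2 * (Real.pi : ℂ) * Complex.I)⁻¹ •
      ∫ θ in (0 : ℝ)..2 * Real.pi, c θ • f (z + circleMap 0 r θ • v) := by
    filter_upwards [Metric.ball_mem_nhds z₀ hR] with z hz using hcauchy z hz
  refine DifferentiableAt.congr_of_eventuallyEq ?_ hcongr
  refine DifferentiableAt.const_smul ?_ _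
  have hz₀R : z₀ ∈ Metric.ball z₀ R := Metric.mem_ball_self hR
  refine (intervalIntegral.hasFDerivAt_integral_of_dominated_of_fderiv_le (𝕜 := ℂ)
    (F := fun z θ => c θ • f (z + circleMap 0 r θ • v))
    (F' := fun z θ => c θ • fderiv ℂ f (z + circleMap 0 r θ • v))
    (bound := fun θ => ‖c θ‖ * (‖fderiv ℂ f z₀‖ + 1)) (Metric.ball_mem_nhds z₀ hR) ?_ ?_ ?_ ?_ ?_
    ?_).differentiableAt
  · filter_upwards [Metric.ball_mem_nhds z₀ hR] with z hz
    exact (hcc.smul (hline z hz)).aestronglyMeasurable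
  · exact (hcc.smul (hline z₀ hz₀R)).intervalIntegrable _ _
  · refine (hcc.smul ?_).aestronglyMeasurable
    refine continuous_iff_continuousAt.2 fun θ => ?_
    exact ContinuousAt.comp (g := fderiv ℂ f) (hcont.continuousAt
      (hU.mem_nhds (hball _ (hmem z₀ hz₀R _ (hnorm θ).le)).1)) (by fun_prop)
  · refine Eventually.of_forall fun θ _ z hz => ?_
    rw [norm_smul]
    exact mul_le_mul_of_nonneg_left (hball _ (hmem z hz _ (hnorm θ).le)).2.le (norm_nonneg _)
  · exact (hcc.norm.mul continuous_const).intervalIntegrable _ _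
  · refine Eventually.of_forall fun θ _ z hz => ?_
    have h1 : HasFDerivAt f _ (z + circleMap 0 r θ • v) :=
      (hdiff _ (hmem z hz _ (hnorm θ).le)).hasFDerivAt
    exact (h1.comp z ((hasFDerivAt_id z).add_const _)).const_smul (c θ)

/-- In finite dimension, holomorphic maps are twice continuously differentiable. -/
theorem DifferentiableOn.contDiffOn_two_complex {E F : Type*} [NormedAddCommGroup E]
    [NormedSpace ℂ E] [FiniteDimensional ℂ E] [NormedAddCommGroup F] [NormedSpace ℂ F]
    [CompleteSpace F] {f : E → F} {U : Set E} (hf : DifferentiableOn ℂ f U) (hU : IsOpen U) :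
    ContDiffOn ℂ 2 f U := by
  have h1 : ∀ v, DifferentiableOn ℂ (fun z => fderiv ℂ f z v) U := hf.fderiv_apply_complex hU
  rw [show (2 : WithTop ℕ∞) = 1 + 1 by norm_num, contDiffOn_succ_iff_fderiv_of_isOpen hU]
  refine ⟨hf, by simp, contDiffOn_clm_apply.2 fun v => ?_⟩
  rw [show (1 : WithTop ℕ∞) = 0 + 1 by norm_num, contDiffOn_succ_iff_fderiv_of_isOpen hU]
  exact ⟨h1 v, by simp, contDiffOn_zero.2 ((h1 v).continuousOn_fderiv_complex hU)⟩

/-! ### The Laplacian and a quantitative maximum principle -/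

/-- A complex `C²` function on `ℂⁿ` is harmonic. The Laplacian is the trace of the real second
derivative, and is the same in the orthonormal bases `(eⱼ)` and `(i eⱼ)`; as the second derivative
is complex bilinear, the two traces are opposite. -/
theorem ContDiffAt.laplacian_eq_zero_of_complex {n : ℕ} {f : Cn n → ℂ} {z : Cn n}
    (hf : ContDiffAt ℂ 2 f z) : Laplacian.laplacian f z = 0 := by
  have hD := hf.restrictScalars_iteratedFDeriv (𝕜 := ℝ)
  let J : Cn n ≃ₗᵢ[ℝ] Cn n :=
    { DistribMulAction.toLinearEquiv ℝ (Cn n) (Units.mk0 Complex.I Complex.I_ne_zero) with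
      norm_map' := fun x => by
        change ‖Complex.I • x‖ = ‖x‖
        simp [norm_smul] }
  have hJ : ∀ x, J x = Complex.I • x := fun x => rfl
  let e := stdOrthonormalBasis ℝ (Cn n)
  have h1 : Laplacian.laplacian f z = ∑ i, iteratedFDeriv ℝ 2 f z ![e i, e i] :=
    congrFun (InnerProductSpace.laplacian_eq_iteratedFDeriv_orthonormalBasis f e) z
  have h2 : Laplacian.laplacian f z = ∑ i, iteratedFDeriv ℝ 2 f z ![J (e i), J (e i)] := by
    have := congrFun (InnerProductSpace.laplacian_eq_iteratedFDeriv_orthonormalBasis f (e.map J)) z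
    simpa using this
  have h3 : ∀ x : Cn n,
      iteratedFDeriv ℝ 2 f z ![J x, J x] = -iteratedFDeriv ℝ 2 f z ![x, x] := by
    intro x
    have h4 := (iteratedFDeriv ℂ 2 f z).map_smul_univ (fun _ => Complex.I) ![x, x]
    have h5 : (fun i => Complex.I • (![x, x] : Fin 2 → Cn n) i) = ![J x, J x] := by
      ext i; fin_cases i <;> simp [hJ]
    rw [h5] at h4
    simp only [Fin.prod_const, Complex.I_sq, neg_smul, one_smul] at h4
    rw [← hD]
    simpa only [Function.comp_apply, ContinuousMultilinearMap.coe_restrictScalars] using h4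
  simp only [h3, Finset.sum_neg_distrib] at h2
  rw [← h1] at h2
  exact self_eq_neg.1 h2

section MaximumPrinciple

variable {E : Type*} [NormedAddCommGroup E] [InnerProductSpace ℝ E] [FiniteDimensional ℝ E]

theorem laplacian_norm_sq (z : E) :
    Laplacian.laplacian (fun x : E => ‖x‖ ^ 2) z = 2 * Module.finrank ℝ E := by
  obtain ⟨B, hB⟩ : ∃ B : E →L[ℝ] E →L[ℝ] ℝ, ∀ x y, B x y = inner ℝ x y :=
    ⟨innerSL ℝ, fun _ _ => rfl⟩
  have h1 : fderiv ℝ (fun x : E => ‖x‖ ^ 2) = fun x => (2 • B) x := by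
    ext x y
    simp [hB]
  rw [InnerProductSpace.laplacian_eq_iteratedFDeriv_stdOrthonormalBasis]
  simp only [iteratedFDeriv_two_apply, h1, ContinuousLinearMap.fderiv]
  simp [hB, mul_comm]

theorem IsLocalMax.fderiv_fderiv_apply_nonpos {E : Type*} [NormedAddCommGroup E]
    [NormedSpace ℝ E] {v : E → ℝ} {z : E} (hmax : IsLocalMax v z)
    (hv : ContDiffAt ℝ 2 v z) (e : E) : fderiv ℝ (fderiv ℝ v) z e e ≤ 0 := by
  by_contra! hpos
  have hline : ∀ t : ℝ, HasDerivAt (fun t : ℝ => z + t • e) e t := fun t => by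
    simpa using ((hasDerivAt_id t).smul_const e).const_add z
  have hcont : Tendsto (fun t : ℝ => z + t • e) (𝓝 0) (𝓝 z) := by
    simpa using (hline 0).continuousAt.tendsto
  have hd1 : deriv (fun t : ℝ => v (z + t • e)) =ᶠ[𝓝 0] fun t => fderiv ℝ v (z + t • e) e := by
    have hev : ∀ᶠ y in 𝓝 z, DifferentiableAt ℝ v y :=
      (hv.eventually (by simp)).mono fun y hy => hy.differentiableAt (by simp)
    filter_upwards [hcont.eventually hev] with t ht
    exact (ht.hasFDerivAt.comp_hasDerivAt t (hline t)).deriv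
  have hd2 : deriv (deriv fun t : ℝ => v (z + t • e)) 0 = fderiv ℝ (fderiv ℝ v) z e e := by
    rw [hd1.deriv_eq]
    have h1 : HasFDerivAt (fderiv ℝ v) (fderiv ℝ (fderiv ℝ v) z) (z + (0 : ℝ) • e) := by
      rw [zero_smul, add_zero]
      exact ((hv.fderiv_right (m := 1) (by norm_num)).differentiableAt (by simp)).hasFDerivAt
    have h2 : HasDerivAt (fun t : ℝ => fderiv ℝ v (z + t • e)) (fderiv ℝ (fderiv ℝ v) z e) 0 :=
      h1.comp_hasDerivAt (0 : ℝ) (hline 0)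
    exact ((ContinuousLinearMap.apply ℝ ℝ e).hasFDerivAt.comp_hasDerivAt (0 : ℝ) h2).deriv
  have hmax' : IsLocalMax (fun t : ℝ => v (z + t • e)) 0 := by
    filter_upwards [hcont.eventually hmax] with t ht
    simpa using ht
  have hmin : IsLocalMin (fun t : ℝ => v (z + t • e)) 0 := by
    refine isLocalMin_of_deriv_deriv_pos (by rwa [hd2]) hmax'.deriv_eq_zero ?_
    refine ContinuousAt.comp (g := v) ?_ (hline 0).continuousAt
    simpa using hv.continuousAt
  -- Both a local maximum and a local minimum: the function is constant near `0`.
  have hconst : (fun t : ℝ => v (z + t • e)) =ᶠ[𝓝 0] fun _ => v (z + (0 : ℝ) • e) := by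
    filter_upwards [hmax', hmin] with t h1 h2 using le_antisymm h1 h2
  have : deriv (deriv fun t : ℝ => v (z + t • e)) 0 = 0 := by
    rw [hconst.deriv.deriv_eq]
    simp
  rw [hd2] at this
  exact hpos.ne' this

theorem IsLocalMax.laplacian_nonpos {v : E → ℝ} {z : E} (hmax : IsLocalMax v z)
    (hv : ContDiffAt ℝ 2 v z) : Laplacian.laplacian v z ≤ 0 := by
  rw [InnerProductSpace.laplacian_eq_iteratedFDeriv_stdOrthonormalBasis]
  refine Finset.sum_nonpos fun i _ => ?_
  rw [iteratedFDeriv_two_apply]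
  exact hmax.fderiv_fderiv_apply_nonpos hv _

/-- Comparison of a function with Laplacian at least `-s` with the solution
`s (1 - ‖z‖²) / (2 d)` of `Δ w = -s` vanishing on the unit sphere, `d` being the dimension. -/
theorem le_of_neg_le_laplacian [Nontrivial E] {w : E → ℝ} {s : ℝ}
    (hw : ContDiffOn ℝ 2 w (Metric.ball 0 1)) (hc : ContinuousOn w (Metric.closedBall 0 1))
    (hb : ∀ z ∈ Metric.sphere (0 : E) 1, w z ≤ 0)
    (hΔ : ∀ z ∈ Metric.ball (0 : E) 1, -s ≤ Laplacian.laplacian w z) {z : E}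
    (hz : z ∈ Metric.closedBall (0 : E) 1) :
    w z ≤ s / (2 * Module.finrank ℝ E) * (1 - ‖z‖ ^ 2) := by
  set d : ℝ := ((Module.finrank ℝ E : ℕ) : ℝ) with hd
  have hd1 : 1 ≤ d := by
    rw [hd]; exact_mod_cast Module.finrank_pos (R := ℝ) (M := E)
  refine le_of_forall_pos_le_add fun ε hε => ?_
  -- The slack `ε` makes the Laplacian strictly positive, which excludes an interior maximum.
  set k := (s + ε) / (2 * d) with hk
  have hkd : 2 * d * k = s + ε := by rw [hk]; field_simp
  let q : E → ℝ := k • fun x => ‖x‖ ^ 2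
  have hq : ContDiff ℝ 2 (fun x : E => ‖x‖ ^ 2) := contDiff_norm_sq ℝ
  have hqc : ContDiff ℝ 2 q := hq.const_smul k
  obtain ⟨z₀, hz₀, hmax⟩ := (isCompact_closedBall (0 : E) 1).exists_isMaxOn
    ⟨z, hz⟩ (hc.add hqc.continuous.continuousOn)
  have hsphere : z₀ ∈ Metric.sphere (0 : E) 1 := by
    by_contra hns
    have hball : z₀ ∈ Metric.ball (0 : E) 1 := by
      rw [Metric.mem_ball]
      exact lt_of_le_of_ne hz₀ hns
    have hnhds := Metric.isOpen_ball.mem_nhds hball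
    have hwc : ContDiffAt ℝ 2 w z₀ := hw.contDiffAt hnhds
    have hloc : IsLocalMax (w + q) z₀ :=
      hmax.isLocalMax (mem_of_superset hnhds Metric.ball_subset_closedBall)
    have h1 := hloc.laplacian_nonpos (hwc.add hqc.contDiffAt)
    rw [hwc.laplacian_add hqc.contDiffAt,
      InnerProductSpace.laplacian_smul k hq.contDiffAt, laplacian_norm_sq, smul_eq_mul] at h1
    have h2 := hΔ z₀ hball
    nlinarith
  have hn : ‖z₀‖ = 1 := by simpa using hsphere
  have h1 : w z + k * ‖z‖ ^ 2 ≤ w z₀ + k * ‖z₀‖ ^ 2 := hmax hz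
  rw [hn] at h1
  have hzn : ‖z‖ ≤ 1 := by simpa using hz
  have h2 : k = s / (2 * d) + ε / (2 * d) := by rw [hk, add_div]
  have h3 : ε / (2 * d) ≤ ε := div_le_self hε.le (by linarith)
  have h4 : ε / (2 * d) * (1 - ‖z‖ ^ 2) ≤ ε := by
    refine le_trans (mul_le_of_le_one_right (by positivity) ?_) h3
    nlinarith [norm_nonneg z]
  have h5 : k * (1 - ‖z‖ ^ 2) = s / (2 * d) * (1 - ‖z‖ ^ 2) + ε / (2 * d) * (1 - ‖z‖ ^ 2) := by
    rw [h2]; ring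
  nlinarith [hb z₀ hsphere]

/-- The complex version of the comparison is the real one for the real parts of all rotations. -/
theorem norm_le_of_norm_laplacian_le [Nontrivial E] {u : E → ℂ} {s : ℝ}
    (hu : ContDiffOn ℝ 2 u (Metric.ball 0 1)) (hc : ContinuousOn u (Metric.closedBall 0 1))
    (hb : ∀ z ∈ Metric.sphere (0 : E) 1, u z = 0)
    (hΔ : ∀ z ∈ Metric.ball (0 : E) 1, ‖Laplacian.laplacian u z‖ ≤ s) {z : E}
    (hz : z ∈ Metric.closedBall (0 : E) 1) :
    ‖u z‖ ≤ s / (2 * Module.finrank ℝ E) * (1 - ‖z‖ ^ 2) := by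
  obtain ⟨c, hc1, hcz⟩ : ∃ c : ℂ, ‖c‖ = 1 ∧ c * u z = ‖u z‖ := by
    by_cases h0 : u z = 0
    · exact ⟨1, by simp, by simp [h0]⟩
    · have hn : (‖u z‖ : ℂ) ≠ 0 := by exact_mod_cast norm_ne_zero_iff.2 h0
      refine ⟨‖u z‖ / u z, by simp [h0], by field_simp⟩
  let l : ℂ →L[ℝ] ℝ := Complex.reCLM.comp ((ContinuousLinearMap.mul ℝ ℂ) c)
  have hl : ∀ x, l x = (c * x).re := fun x => rfl
  have h := le_of_neg_le_laplacian (w := l ∘ u) (s := s) (l.contDiff.comp_contDiffOn hu)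
    (l.continuous.comp_continuousOn hc) (fun x hx => by simp [hb x hx])
    (fun x hx => by
      rw [(hu.contDiffAt (Metric.isOpen_ball.mem_nhds hx)).laplacian_CLM_comp_left,
        Function.comp_apply, hl]
      have h1 := (Complex.abs_re_le_norm (c * Laplacian.laplacian u x))
      rw [norm_mul, hc1, one_mul] at h1
      linarith [neg_abs_le (c * Laplacian.laplacian u x).re, hΔ x hx]) hz
  simpa [hl, hcz] using h

end MaximumPrinciple

/-! ### A second-order Schwarz lemma -/

/-- The real Möbius map `x ↦ (x + a) / (1 + a x)`, which for `|a| < 1` is the automorphism of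
`(-1, 1)` taking `0` to `a`. -/
noncomputable def moebius (a x : ℝ) : ℝ := (x + a) / (1 + a * x)

theorem moebius_le_moebius {a x y : ℝ} (ha₀ : 0 ≤ a) (ha₁ : a ≤ 1) (hx : 0 ≤ x) (hxy : x ≤ y) :
    moebius a x ≤ moebius a y := by
  have hy : 0 ≤ y := hx.trans hxy
  rw [moebius, moebius, div_le_div_iff₀ (by positivity) (by positivity)]
  nlinarith [mul_nonneg (sub_nonneg.2 hxy) (by nlinarith : 0 ≤ 1 - a ^ 2)]

theorem moebius_one_left {x : ℝ} (hx : 0 ≤ x) : moebius 1 x = 1 := by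
  rw [moebius, one_mul, add_comm, div_self (by positivity)]

theorem moebius_one_right {a : ℝ} (ha : 0 ≤ a) : moebius a 1 = 1 := by
  rw [moebius, mul_one, div_self (by positivity)]

theorem moebius_nonneg {a x : ℝ} (ha : 0 ≤ a) (hx : 0 ≤ x) : 0 ≤ moebius a x := by
  unfold moebius; positivity

/-- The extremal function of the Schwarz lemma for maps `h` of the disk with `h 0 = 0`,
`|h' 0| = a` and `|h'' 0| = 2 (1 - a ^ 2) b`, on the radius `[0, 1]`. -/
noncomputable def schwarzMajorant (a b r : ℝ) : ℝ := r * moebius a (r * moebius b r)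

theorem hasDerivAt_schwarzMajorant_one {a b : ℝ} (ha : 0 ≤ a) (hb : 0 ≤ b) :
    HasDerivAt (schwarzMajorant a b) (1 + 2 / (1 + b) * ((1 - a) / (1 + a))) 1 := by
  have hm : ∀ {c : ℝ}, 0 ≤ c → HasDerivAt (moebius c) ((1 - c) / (1 + c)) 1 := by
    intro c hc
    have h1 : HasDerivAt (fun x : ℝ => x + c) 1 1 := (hasDerivAt_id 1).add_const c
    have h2 : HasDerivAt (fun x : ℝ => 1 + c * x) c 1 := by
      simpa using ((hasDerivAt_id (1 : ℝ)).const_mul c).const_add 1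
    refine (h1.div h2 (by positivity)).congr_deriv ?_
    field_simp
  have h1 : HasDerivAt (fun r : ℝ => r * moebius b r) (2 / (1 + b)) 1 := by
    refine ((hasDerivAt_id (1 : ℝ)).mul (hm hb)).congr_deriv ?_
    rw [moebius_one_right hb]
    simp only [id]
    field_simp
    ring
  have hb1 : (1 : ℝ) * moebius b 1 = 1 := by rw [moebius_one_right hb, mul_one]
  have h2 : HasDerivAt (fun r : ℝ => moebius a (r * moebius b r))
      ((1 - a) / (1 + a) * (2 / (1 + b))) 1 := by
    have h3 : HasDerivAt (moebius a) ((1 - a) / (1 + a)) (1 * moebius b 1) := by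
      rw [hb1]; exact hm ha
    exact HasDerivAt.comp (1 : ℝ) h3 h1
  refine ((hasDerivAt_id (1 : ℝ)).mul h2).congr_deriv ?_
  simp only [id, hb1, moebius_one_right ha]
  ring

theorem schwarzMajorant_one {a b : ℝ} (ha : 0 ≤ a) (hb : 0 ≤ b) : schwarzMajorant a b 1 = 1 := by
  simp [schwarzMajorant, moebius_one_right, ha, hb]

/-- The bound `hopfBound` is the one-sided derivative at `1` of the difference between the Schwarz
majorant and the solution `s (1 - r²) / (4 n)` of the comparison problem. -/
theorem tendsto_hopfBound (n : ℕ) {a b : ℝ} (ha : 0 ≤ a) (hb : 0 ≤ b) (s : ℝ) :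
    Tendsto (fun r : ℝ => (1 - schwarzMajorant a b r - s / (4 * n) * (1 - r ^ 2)) / (1 - r))
      (𝓝[<] 1) (𝓝 (hopfBound n a b s)) := by
  have h1 : HasDerivAt (fun r : ℝ => 1 - schwarzMajorant a b r - s / (4 * n) * (1 - r ^ 2))
      (-hopfBound n a b s) 1 := by
    have h2 : HasDerivAt (fun r : ℝ => s / (4 * n) * (1 - r ^ 2)) (s / (4 * n) * (-(2 * 1))) 1 := by
      simpa using (((hasDerivAt_id (1 : ℝ)).pow 2).const_sub 1).const_mul (s / (4 * n))
    refine (((hasDerivAt_schwarzMajorant_one ha hb).const_sub 1).sub h2).congr_deriv ?_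
    have h3 : s / (4 * n) * 2 = s / (2 * n) := by
      rw [show (4 : ℝ) * n = 2 * n * 2 by ring, ← div_div, div_mul_cancel₀ _ two_ne_zero]
    rw [hopfBound]
    linarith
  have h4 := (hasDerivAt_iff_tendsto_slope.1 h1).neg.mono_left
    (nhdsWithin_mono (1 : ℝ) (fun x (hx : x < 1) => hx.ne : Set.Iio (1 : ℝ) ⊆ {1}ᶜ))
  rw [neg_neg] at h4
  refine h4.congr' (eventually_nhdsWithin_of_forall fun r _ => ?_)
  rw [slope_def_field, schwarzMajorant_one ha hb, ← div_neg, neg_sub]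
  simp

theorem norm_one_sub_conj_mul_sq (c k : ℂ) :
    ‖1 - (starRingEnd ℂ) c * k‖ ^ 2 = ‖k - c‖ ^ 2 + (1 - ‖c‖ ^ 2) * (1 - ‖k‖ ^ 2) := by
  simp only [← Complex.normSq_eq_norm_sq, Complex.normSq_apply, Complex.sub_re, Complex.sub_im,
    Complex.mul_re, Complex.mul_im, Complex.conj_re, Complex.conj_im, Complex.one_re,
    Complex.one_im]
  ring

theorem one_sub_conj_mul_ne_zero {c k : ℂ} (hc : ‖c‖ < 1) (hk : ‖k‖ ≤ 1) :
    1 - (starRingEnd ℂ) c * k ≠ 0 := by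
  intro h
  have h1 : ‖(starRingEnd ℂ) c * k‖ = 1 := by rw [← sub_eq_zero.1 h, norm_one]
  rw [norm_mul, RCLike.norm_conj] at h1
  nlinarith [norm_nonneg c, norm_nonneg k]

/-- A point of the disk is recovered from its image under the disk automorphism sending `c` to
`0`; the modulus is largest when all three points are aligned. -/
theorem norm_le_moebius_norm_div {c k : ℂ} (hc : ‖c‖ < 1) (hk : ‖k‖ ≤ 1) :
    ‖k‖ ≤ moebius ‖c‖ ‖(k - c) / (1 - (starRingEnd ℂ) c * k)‖ := by
  have hden := norm_pos_iff.2 (one_sub_conj_mul_ne_zero hc hk)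
  have hid := norm_one_sub_conj_mul_sq c k
  have htri : |‖k‖ - ‖c‖| ≤ ‖k - c‖ := abs_norm_sub_norm_le k c
  rw [norm_div, moebius, le_div_iff₀ (by positivity)]
  set x := ‖k - c‖
  set D := ‖1 - (starRingEnd ℂ) c * k‖
  set p := ‖k‖
  set q := ‖c‖
  have hq : 0 ≤ q := norm_nonneg c
  have hp : 0 ≤ p := norm_nonneg k
  have hx : 0 ≤ x := norm_nonneg _
  have hpq : 0 < 1 - q * p := by nlinarith
  have hP : 0 ≤ (1 - q ^ 2) * (1 - p ^ 2) := mul_nonneg (by nlinarith) (by nlinarith)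
  have hsq : (p - q) ^ 2 ≤ x ^ 2 := by
    rw [← sq_abs (p - q)]; exact pow_le_pow_left₀ (abs_nonneg _) htri 2
  have key : (p - q) * D ≤ x * (1 - q * p) := by
    refine abs_le_of_sq_le_sq' ?_ (by positivity) |>.2
    rw [mul_pow, mul_pow, hid]
    nlinarith [mul_nonneg hP (sub_nonneg.2 hsq)]
  have key' : p - q ≤ x / D * (1 - q * p) := by
    rw [div_mul_eq_mul_div, le_div_iff₀ hden]; exact key
  linarith

theorem norm_sub_div_one_sub_conj_mul_le_one {c k : ℂ} (hc : ‖c‖ < 1) (hk : ‖k‖ ≤ 1) :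
    ‖(k - c) / (1 - (starRingEnd ℂ) c * k)‖ ≤ 1 := by
  rw [norm_div]
  refine div_le_one_of_le₀ ?_ (norm_nonneg _)
  refine abs_le_of_sq_le_sq' ?_ (norm_nonneg _) |>.2
  have hid := norm_one_sub_conj_mul_sq c k
  have hP : 0 ≤ (1 - ‖c‖ ^ 2) * (1 - ‖k‖ ^ 2) :=
    mul_nonneg (by nlinarith [norm_nonneg c]) (by nlinarith [norm_nonneg k])
  linarith

/-- Normalisation of a disk map `k` at the origin: `q` is the quotient by `z` of `k` followed by the
disk automorphism that sends `k 0` to `0`. -/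
theorem exists_schwarz_quotient {k : ℂ → ℂ} (hd : DifferentiableOn ℂ k (Metric.ball 0 1))
    (hk : ∀ z ∈ Metric.ball (0 : ℂ) 1, ‖k z‖ ≤ 1) (h0 : ‖k 0‖ < 1) :
    ∃ q : ℂ → ℂ, DifferentiableOn ℂ q (Metric.ball 0 1) ∧
      (∀ z ∈ Metric.ball (0 : ℂ) 1, ‖q z‖ ≤ 1) ∧ q 0 = deriv k 0 / (1 - ‖k 0‖ ^ 2) ∧
      ∀ z ∈ Metric.ball (0 : ℂ) 1, ‖k z‖ ≤ moebius ‖k 0‖ (‖z‖ * ‖q z‖) := by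
  have h0b : (0 : ℂ) ∈ Metric.ball (0 : ℂ) 1 := Metric.mem_ball_self one_pos
  have hnhds : Metric.ball (0 : ℂ) 1 ∈ 𝓝 (0 : ℂ) := Metric.ball_mem_nhds _ one_pos
  set c := k 0 with hc
  set m : ℂ → ℂ := fun z => (k z - c) / (1 - (starRingEnd ℂ) c * k z) with hm
  have hmd : DifferentiableOn ℂ m (Metric.ball 0 1) :=
    (hd.sub_const c).div ((hd.const_mul _).const_sub 1)
      fun z hz => one_sub_conj_mul_ne_zero h0 (hk z hz)
  have hm0 : m 0 = 0 := by simp [hm, hc]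
  have hmaps : Set.MapsTo m (Metric.ball 0 1) (Metric.closedBall (m 0) 1) := fun z hz => by
    rw [hm0, mem_closedBall_zero_iff]
    exact norm_sub_div_one_sub_conj_mul_le_one h0 (hk z hz)
  refine ⟨dslope m 0, (Complex.differentiableOn_dslope hnhds).2 hmd, fun z hz => ?_, ?_,
    fun z hz => ?_⟩
  · simpa using Complex.norm_dslope_le_div_of_mapsTo_ball hmd hmaps hz
  · rw [dslope_same]
    have hk' := (hd.differentiableAt hnhds).hasDerivAt
    have h1 := (hk'.sub_const c).div ((hk'.const_mul ((starRingEnd ℂ) c)).const_sub 1)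
      (one_sub_conj_mul_ne_zero h0 (hk 0 h0b))
    have hcc : (starRingEnd ℂ) c * c = (‖c‖ : ℂ) ^ 2 := Complex.conj_mul' c
    have hne := one_sub_conj_mul_ne_zero h0 h0.le
    refine (HasDerivAt.deriv h1).trans ?_
    rw [← hc, sub_self, zero_mul, sub_zero, pow_two, mul_div_mul_right _ _ hne, hcc]
  · have h1 : m z = z * dslope m 0 z := by
      have := sub_smul_dslope m 0 z
      rw [hm0, sub_zero, sub_zero, smul_eq_mul] at this
      exact this.symm
    rw [← norm_mul, ← h1]
    exact norm_le_moebius_norm_div h0 (hk z hz)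

/-- The Schwarz–Pick inequality between the points `0` and `z`. -/
theorem norm_le_moebius_norm {k : ℂ → ℂ} (hd : DifferentiableOn ℂ k (Metric.ball 0 1))
    (hk : ∀ z ∈ Metric.ball (0 : ℂ) 1, ‖k z‖ ≤ 1) {z : ℂ} (hz : z ∈ Metric.ball (0 : ℂ) 1) :
    ‖k z‖ ≤ moebius ‖k 0‖ ‖z‖ := by
  have h0b : (0 : ℂ) ∈ Metric.ball (0 : ℂ) 1 := Metric.mem_ball_self one_pos
  rcases (hk 0 h0b).lt_or_eq with h0 | h0
  · obtain ⟨q, -, hq, -, hle⟩ := exists_schwarz_quotient hd hk h0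
    exact (hle z hz).trans (moebius_le_moebius (norm_nonneg _) h0.le (by positivity)
      (mul_le_of_le_one_right (norm_nonneg z) (hq z hz)))
  · rw [h0, moebius_one_left (norm_nonneg z)]
    exact hk z hz

theorem deriv_deriv_id_mul_zero {k : ℂ → ℂ} (hk : DifferentiableOn ℂ k (Metric.ball 0 1)) :
    deriv (deriv fun z => z * k z) 0 = 2 * deriv k 0 := by
  have hnhds : Metric.ball (0 : ℂ) 1 ∈ 𝓝 (0 : ℂ) := Metric.ball_mem_nhds _ one_pos
  have h1 : deriv (fun z => z * k z) =ᶠ[𝓝 0] fun z => k z + z * deriv k z := by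
    filter_upwards [hnhds] with z hz
    have h2 := (hasDerivAt_id z).mul
      (hk.differentiableAt (Metric.isOpen_ball.mem_nhds hz)).hasDerivAt
    refine (HasDerivAt.deriv h2).trans ?_
    simp
  rw [h1.deriv_eq]
  have h3 := ((hk.deriv Metric.isOpen_ball).differentiableAt hnhds).hasDerivAt
  have h4 := (hk.differentiableAt hnhds).hasDerivAt.add ((hasDerivAt_id (0 : ℂ)).mul h3)
  refine (HasDerivAt.deriv h4).trans ?_
  simp only [id, one_mul, zero_mul, add_zero]
  ring

/-- A second-order Schwarz lemma: the Schwarz lemma is applied to `h`, then to the disk map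
`h z / z` normalised at the origin. -/
theorem norm_le_schwarzMajorant {h : ℂ → ℂ} (hd : DifferentiableOn ℂ h (Metric.ball 0 1))
    (hh : ∀ z ∈ Metric.ball (0 : ℂ) 1, ‖h z‖ ≤ 1) (h0 : h 0 = 0) {a b : ℝ} (ha : a = ‖deriv h 0‖)
    (hb : b = if a < 1 then ‖deriv (deriv h) 0‖ / (2 * (1 - a ^ 2)) else 1) :
    0 ≤ b ∧ ∀ z ∈ Metric.ball (0 : ℂ) 1, ‖h z‖ ≤ schwarzMajorant a b ‖z‖ := by
  have h0b : (0 : ℂ) ∈ Metric.ball (0 : ℂ) 1 := Metric.mem_ball_self one_pos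
  have hnhds : Metric.ball (0 : ℂ) 1 ∈ 𝓝 (0 : ℂ) := Metric.ball_mem_nhds _ one_pos
  have hmaps : Set.MapsTo h (Metric.ball 0 1) (Metric.closedBall (h 0) 1) := fun z hz => by
    rw [h0, mem_closedBall_zero_iff]; exact hh z hz
  set k := dslope h 0 with hkdef
  have hk0 : a = ‖k 0‖ := by rw [ha, hkdef, dslope_same]
  have hkd : DifferentiableOn ℂ k (Metric.ball 0 1) :=
    (Complex.differentiableOn_dslope hnhds).2 hd
  have hk1 : ∀ z ∈ Metric.ball (0 : ℂ) 1, ‖k z‖ ≤ 1 := fun z hz => by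
    simpa using Complex.norm_dslope_le_div_of_mapsTo_ball hd hmaps hz
  have hmul : h = fun z => z * k z := by
    ext z
    have := sub_smul_dslope h 0 z
    rw [h0, sub_zero, sub_zero, smul_eq_mul] at this
    exact this.symm
  have hnorm : ∀ z, ‖h z‖ = ‖z‖ * ‖k z‖ := fun z => by
    rw [← norm_mul]; exact congrArg norm (congrFun hmul z)
  rcases (hk1 0 h0b).lt_or_eq with hlt | heq
  · obtain ⟨q, hqd, hq1, hq0, hle⟩ := exists_schwarz_quotient hkd hk1 hlt
    have hderiv : deriv (deriv h) 0 = 2 * deriv k 0 := by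
      rw [hmul]; exact deriv_deriv_id_mul_zero hkd
    have hpos : 0 < 1 - ‖k 0‖ ^ 2 := by nlinarith [norm_nonneg (k 0)]
    have hbq : ‖deriv (deriv h) 0‖ / (2 * (1 - ‖k 0‖ ^ 2)) = ‖q 0‖ := by
      have hcast : (1 : ℂ) - (‖k 0‖ : ℂ) ^ 2 = ((1 - ‖k 0‖ ^ 2 : ℝ) : ℂ) := by push_cast; ring
      rw [hq0, hderiv, norm_div, norm_mul, hcast, Complex.norm_real, Real.norm_of_nonneg hpos.le,
        Complex.norm_ofNat, mul_div_mul_left _ _ two_ne_zero]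
    rw [hk0, if_pos hlt, hbq] at hb
    rw [hb, hk0]
    refine ⟨norm_nonneg _, fun z hz => ?_⟩
    rw [hnorm, schwarzMajorant]
    refine mul_le_mul_of_nonneg_left ((hle z hz).trans ?_) (norm_nonneg z)
    exact moebius_le_moebius (norm_nonneg _) hlt.le (by positivity)
      (mul_le_mul_of_nonneg_left (norm_le_moebius_norm hqd hq1 hz) (norm_nonneg z))
  · -- Here `a = 1`, and the majorant reduces to the identity.
    rw [hk0, if_neg heq.not_lt] at hb
    rw [hb, hk0]
    refine ⟨one_pos.le, fun z hz => ?_⟩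
    rw [hnorm, schwarzMajorant, heq, moebius_one_left
      (mul_nonneg (norm_nonneg z) (moebius_nonneg one_pos.le (norm_nonneg z)))]
    exact mul_le_mul_of_nonneg_left (hk1 z hz) (norm_nonneg z)

/-! ### The boundary lower bound -/

section Slices

variable {n : ℕ} {φ : Cn n → ℂ} {η : Cn n}

theorem smul_mem_ball_of_mem_sphere (hη : η ∈ Metric.sphere (0 : Cn n) 1) {ζ : ℂ}
    (hζ : ζ ∈ Metric.ball (0 : ℂ) 1) : ζ • η ∈ Metric.ball (0 : Cn n) 1 := by
  rw [mem_sphere_zero_iff_norm] at hη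
  rw [mem_ball_zero_iff] at hζ ⊢
  rwa [norm_smul, hη, mul_one]

theorem hasDerivAt_slice (hφ : DifferentiableOn ℂ φ (Metric.ball 0 1))
    (hη : η ∈ Metric.sphere (0 : Cn n) 1) {ζ : ℂ} (hζ : ζ ∈ Metric.ball (0 : ℂ) 1) :
    HasDerivAt (fun ζ : ℂ => φ (ζ • η)) (fderiv ℂ φ (ζ • η) η) ζ := by
  have h1 := (hφ.differentiableAt
    (Metric.isOpen_ball.mem_nhds (smul_mem_ball_of_mem_sphere hη hζ))).hasFDerivAt
  have h2 : HasDerivAt (fun ζ : ℂ => ζ • η) η ζ := by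
    simpa using (hasDerivAt_id ζ).smul_const η
  exact h1.comp_hasDerivAt ζ h2

theorem firstOrder_eq_norm_deriv (hφ : DifferentiableOn ℂ φ (Metric.ball 0 1))
    (hη : η ∈ Metric.sphere (0 : Cn n) 1) :
    firstOrder φ η = ‖deriv (fun ζ : ℂ => φ (ζ • η)) 0‖ := by
  rw [(hasDerivAt_slice hφ hη (Metric.mem_ball_self one_pos)).deriv, zero_smul, firstOrder]

/-- The second derivative of the slice computes the iterated Fréchet derivative in `lambdaZero`
because `φ` is twice differentiable at `0`; this is where smoothness in several variables enters. -/
theorem lambdaZero_eq_deriv_deriv (hφ : DifferentiableOn ℂ φ (Metric.ball 0 1))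
    (hη : η ∈ Metric.sphere (0 : Cn n) 1) :
    lambdaZero φ η = if firstOrder φ η < 1 then
      ‖deriv (deriv fun ζ : ℂ => φ (ζ • η)) 0‖ / (2 * (1 - firstOrder φ η ^ 2)) else 1 := by
  have h0 : (0 : Cn n) ∈ Metric.ball (0 : Cn n) 1 := Metric.mem_ball_self one_pos
  have h1 : deriv (fun ζ : ℂ => φ (ζ • η)) =ᶠ[𝓝 0] fun ζ => fderiv ℂ φ (ζ • η) η := by
    filter_upwards [Metric.ball_mem_nhds (0 : ℂ) one_pos] with ζ hζ
    exact (hasDerivAt_slice hφ hη hζ).deriv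
  have h2 : ContDiffAt ℂ 2 φ 0 :=
    (hφ.contDiffOn_two_complex Metric.isOpen_ball).contDiffAt (Metric.isOpen_ball.mem_nhds h0)
  have h3 : HasFDerivAt (fderiv ℂ φ) (fderiv ℂ (fderiv ℂ φ) 0) ((0 : ℂ) • η) := by
    rw [zero_smul]
    exact ((h2.fderiv_right (m := 1) (by norm_num)).differentiableAt (by simp)).hasFDerivAt
  have h4 : HasDerivAt (fun ζ : ℂ => ζ • η) η 0 := by
    simpa using (hasDerivAt_id (0 : ℂ)).smul_const η
  have h5 : HasDerivAt (fun ζ : ℂ => fderiv ℂ φ (ζ • η)) (fderiv ℂ (fderiv ℂ φ) 0 η) 0 :=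
    h3.comp_hasDerivAt (0 : ℂ) h4
  have h6 : deriv (fun ζ : ℂ => fderiv ℂ φ (ζ • η) η) 0 = fderiv ℂ (fderiv ℂ φ) 0 η η :=
    ((ContinuousLinearMap.apply ℂ ℂ η).hasFDerivAt.comp_hasDerivAt (0 : ℂ) h5).deriv
  rw [lambdaZero, h1.deriv_eq, h6, iteratedFDeriv_two_apply]
  simp

theorem IsHolomorphicDatum.norm_slice_le_one (hφ : IsHolomorphicDatum φ)
    (hη : η ∈ Metric.sphere (0 : Cn n) 1) {ζ : ℂ} (hζ : ζ ∈ Metric.ball (0 : ℂ) 1) :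
    ‖φ (ζ • η)‖ ≤ 1 := by
  have hn : ‖η‖ = 1 := mem_sphere_zero_iff_norm.1 hη
  have hd : DiffContOnCl ℂ (fun ζ : ℂ => φ (ζ • η)) (Metric.ball 0 1) := by
    refine ⟨fun w hw =>
      (hasDerivAt_slice hφ.holomorphic hη hw).differentiableAt.differentiableWithinAt, ?_⟩
    rw [closure_ball _ one_ne_zero]
    refine hφ.continuousOn.comp (by fun_prop) fun w hw => ?_
    rw [mem_closedBall_zero_iff] at hw ⊢
    rwa [norm_smul, hn, mul_one]
  refine Complex.norm_le_of_forall_mem_frontier_norm_le Metric.isBounded_ball hd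
    (fun w hw => ?_) (subset_closure hζ)
  rw [frontier_ball _ one_ne_zero, mem_sphere_zero_iff_norm] at hw
  exact hφ.norm_le_one _ (by rw [mem_sphere_zero_iff_norm, norm_smul, hw, hn, one_mul])

end Slices

theorem finrank_real_Cn (n : ℕ) : Module.finrank ℝ (Cn n) = 2 * n := by
  have := finrank_real_of_complex (Cn n)
  rwa [finrank_euclideanSpace_fin] at this

theorem norm_le_supNormBall {n : ℕ} {g : Cn n → ℂ}
    (hg : ContinuousOn g (Metric.closedBall 0 1)) {z : Cn n} (hz : z ∈ Metric.ball (0 : Cn n) 1) :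
    ‖g z‖ ≤ supNormBall g := by
  obtain ⟨C, hC⟩ := (isCompact_closedBall (0 : Cn n) 1).exists_bound_of_continuousOn hg
  refine le_ciSup (f := fun z : Metric.ball (0 : Cn n) 1 => ‖g z‖) ⟨C, ?_⟩ ⟨z, hz⟩
  rintro _ ⟨w, rfl⟩
  exact hC w (Metric.ball_subset_closedBall w.2)

/-- A solution of the Poisson problem differs from its holomorphic boundary datum, which is
harmonic, by at most the radial solution with constant right-hand side. -/
theorem IsPoissonSolution.norm_sub_le {n : ℕ} (hn : 1 ≤ n) {g φ f : Cn n → ℂ}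
    (hφ : IsHolomorphicDatum φ) (hg : ContinuousOn g (Metric.closedBall 0 1))
    (hf : IsPoissonSolution g φ f) {z : Cn n} (hz : z ∈ Metric.closedBall (0 : Cn n) 1) :
    ‖f z - φ z‖ ≤ supNormBall g / (4 * n) * (1 - ‖z‖ ^ 2) := by
  have : Nonempty (Fin n) := ⟨⟨0, hn⟩⟩
  have : Nontrivial (Cn n) := inferInstance
  have hφ2 : ContDiffOn ℂ 2 φ (Metric.ball 0 1) :=
    hφ.holomorphic.contDiffOn_two_complex Metric.isOpen_ball
  have h := norm_le_of_norm_laplacian_le (u := f - φ) (s := supNormBall g)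
    (hf.contDiffOn.sub (hφ2.restrict_scalars ℝ)) (hf.continuousOn.sub hφ.continuousOn)
    (fun x hx => by simp [hf.boundary_eq x hx])
    (fun x hx => by
      have hnhds := Metric.isOpen_ball.mem_nhds hx
      have hφx := hφ2.contDiffAt hnhds
      rw [(hf.contDiffOn.contDiffAt hnhds).laplacian_sub (hφx.restrict_scalars ℝ),
        hφx.laplacian_eq_zero_of_complex, sub_zero, hf.laplacian_eq x hx]
      exact norm_le_supNormBall hg hx) hz
  rw [finrank_real_Cn] at h
  push_cast at h
  rwa [show (2 : ℝ) * (2 * n) = 4 * n by ring] at h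

/-- The solution is compared along the radius with its holomorphic boundary datum, whose modulus is
controlled by the second-order Schwarz lemma on the complex line through `η`. -/
theorem hopfBound_le_radialLiminf {n : ℕ} (hn : 1 ≤ n) {φ g f : Cn n → ℂ}
    (hφ : IsHolomorphicDatum φ) (hg : ContinuousOn g (Metric.closedBall 0 1))
    (hf : IsPoissonSolution g φ f) {η : Cn n} (hη : η ∈ Metric.sphere (0 : Cn n) 1)
    (hlim : Tendsto (fun r : ℝ => ‖f (r • η)‖) (𝓝[<] (1 : ℝ)) (𝓝 1)) :
    ((hopfBound n (firstOrder φ η) (lambdaZero φ η) (supNormBall g) : ℝ) : EReal)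
      ≤ radialLiminf f η := by
  have hη1 : ‖η‖ = 1 := mem_sphere_zero_iff_norm.1 hη
  have hIoo : ∀ᶠ r : ℝ in 𝓝[<] 1, r ∈ Set.Ioo (0 : ℝ) 1 := Ioo_mem_nhdsLT one_pos
  have hrη : ∀ r ∈ Set.Ioo (0 : ℝ) 1, ‖r • η‖ = r := fun r hr => by
    rw [norm_smul, hη1, mul_one, Real.norm_of_nonneg hr.1.le]
  have hmem : ∀ r ∈ Set.Ioo (0 : ℝ) 1, r • η ∈ Metric.closedBall (0 : Cn n) 1 := fun r hr => by
    rw [mem_closedBall_zero_iff, hrη r hr]; exact hr.2.le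
  -- `f` is continuous up to the sphere, so the hypothesis on the limit says that `‖f η‖ = 1`.
  have hfη : ‖f η‖ = 1 := by
    have h1 : Tendsto (fun r : ℝ => r • η) (𝓝[<] 1) (𝓝[Metric.closedBall 0 1] η) := by
      refine tendsto_nhdsWithin_iff.2 ⟨?_, hIoo.mono hmem⟩
      have : Continuous fun r : ℝ => r • η := by fun_prop
      simpa using (this.tendsto 1).mono_left nhdsWithin_le_nhds
    have h2 := (hf.continuousOn η (Metric.sphere_subset_closedBall hη)).tendsto.comp h1
    exact tendsto_nhds_unique h2.norm hlim
  obtain ⟨hb0, hle⟩ := norm_le_schwarzMajorant (h := fun ζ : ℂ => φ (ζ • η))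
    (fun ζ hζ => (hasDerivAt_slice hφ.holomorphic hη hζ).differentiableAt.differentiableWithinAt)
    (fun ζ hζ => hφ.norm_slice_le_one hη hζ) (by simpa using hφ.map_zero)
    (firstOrder_eq_norm_deriv hφ.holomorphic hη) (lambdaZero_eq_deriv_deriv hφ.holomorphic hη)
  have ha0 : 0 ≤ firstOrder φ η := norm_nonneg _
  have hT := (continuous_coe_real_ereal.tendsto _).comp
    (tendsto_hopfBound n ha0 hb0 (supNormBall g))
  rw [← hT.liminf_eq, radialLiminf]
  refine liminf_le_liminf ?_
  filter_upwards [hIoo] with r hr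
  have h1 : ‖φ (r • η)‖ ≤ schwarzMajorant (firstOrder φ η) (lambdaZero φ η) r := by
    have := hle (r : ℂ) (by simpa [abs_of_pos hr.1] using hr.2)
    rwa [Complex.coe_smul, Complex.norm_real, Real.norm_of_nonneg hr.1.le] at this
  have h2 := hf.norm_sub_le hn hφ hg (hmem r hr)
  rw [hrη r hr] at h2
  have h3 : ‖f (r • η)‖ ≤ ‖f (r • η) - φ (r • η)‖ + ‖φ (r • η)‖ := by
    simpa using norm_add_le (f (r • η) - φ (r • η)) (φ (r • η))
  have h4 : ‖f η‖ - ‖f (r • η)‖ ≤ ‖f η - f (r • η)‖ := norm_sub_norm_le _ _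
  refine EReal.coe_le_coe_iff.2 (div_le_div_of_nonneg_right ?_ (sub_nonneg.2 hr.2.le))
  linarith

/-! ### The extremal functions -/

/-- The disk automorphism `w ↦ (w + a) / (1 + a w)` for real `0 ≤ a < 1`, and the constant `1` in
the degenerate case `a = 1`, where the quotient has a removable singularity at `-1`. -/
noncomputable def diskMoebius (a : ℝ) (w : ℂ) : ℂ :=
  if a = 1 then 1 else (w + a) / (1 + a * w)

section DiskMoebius

variable {a : ℝ} {w : ℂ}

theorem one_add_mul_ne_zero (ha₀ : 0 ≤ a) (ha₁ : a < 1) (hw : ‖w‖ ≤ 1) : 1 + a * w ≠ 0 := by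
  have h := one_sub_conj_mul_ne_zero (c := -(a : ℂ)) (k := w)
    (by rwa [norm_neg, Complex.norm_real, Real.norm_of_nonneg ha₀]) hw
  simpa using h

theorem hasDerivAt_diskMoebius (ha₀ : 0 ≤ a) (ha₁ : a ≤ 1) (hw : ‖w‖ ≤ 1) :
    HasDerivAt (diskMoebius a) (if a = 1 then 0 else (1 - a ^ 2) / (1 + a * w) ^ 2) w := by
  rcases ha₁.lt_or_eq with h | rfl
  · have h1 : HasDerivAt (fun w : ℂ => w + a) 1 w := (hasDerivAt_id w).add_const _
    have h2 : HasDerivAt (fun w : ℂ => 1 + a * w) a w := by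
      simpa using ((hasDerivAt_id w).const_mul (a : ℂ)).const_add 1
    have h3 : diskMoebius a = fun w : ℂ => (w + a) / (1 + a * w) := by
      ext w; rw [diskMoebius, if_neg h.ne]
    rw [h3, if_neg h.ne]
    refine (h1.div h2 (one_add_mul_ne_zero ha₀ h hw)).congr_deriv ?_
    congr 1
    ring
  · have h3 : diskMoebius 1 = fun _ : ℂ => 1 := by ext w; simp [diskMoebius]
    rw [h3, if_pos rfl]
    exact hasDerivAt_const w 1

theorem norm_diskMoebius_le_one (ha₀ : 0 ≤ a) (ha₁ : a ≤ 1) (hw : ‖w‖ ≤ 1) :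
    ‖diskMoebius a w‖ ≤ 1 := by
  rcases ha₁.lt_or_eq with h | rfl
  · have := norm_sub_div_one_sub_conj_mul_le_one (c := -(a : ℂ)) (k := w)
      (by rwa [norm_neg, Complex.norm_real, Real.norm_of_nonneg ha₀]) hw
    rw [diskMoebius, if_neg h.ne]
    simpa using this
  · simp [diskMoebius]

theorem diskMoebius_zero (a : ℝ) : diskMoebius a 0 = a := by
  by_cases h : a = 1 <;> simp [diskMoebius, h]

theorem deriv_diskMoebius_zero (ha₀ : 0 ≤ a) (ha₁ : a ≤ 1) :
    deriv (diskMoebius a) 0 = 1 - a ^ 2 := by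
  rw [(hasDerivAt_diskMoebius ha₀ ha₁ (by simp)).deriv]
  by_cases h : a = 1 <;> simp [h]

theorem diskMoebius_ofReal (a : ℝ) {x : ℝ} (hx : 0 ≤ x) :
    diskMoebius a x = (moebius a x : ℂ) := by
  by_cases h : a = 1
  · rw [h, moebius_one_left hx]; simp [diskMoebius]
  · rw [diskMoebius, if_neg h, moebius]; push_cast; rfl

end DiskMoebius

/-- The extremal function of the second-order Schwarz lemma: a holomorphic self-map of the disk
that fixes `0` and `1`, with first derivative `a` and second derivative `2 (1 - a ^ 2) b` at `0`. -/
noncomputable def schwarzExtremal (a b : ℝ) (w : ℂ) : ℂ :=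
  w * diskMoebius a (w * diskMoebius b w)

section SchwarzExtremal

variable {a b : ℝ} {w : ℂ}

theorem norm_mul_diskMoebius_le_one (hb₀ : 0 ≤ b) (hb₁ : b ≤ 1) (hw : ‖w‖ ≤ 1) :
    ‖w * diskMoebius b w‖ ≤ 1 := by
  rw [norm_mul]
  exact mul_le_one₀ hw (norm_nonneg _) (norm_diskMoebius_le_one hb₀ hb₁ hw)

theorem hasDerivAt_diskMoebius_mul (ha₀ : 0 ≤ a) (ha₁ : a ≤ 1) (hb₀ : 0 ≤ b) (hb₁ : b ≤ 1)
    (hw : ‖w‖ ≤ 1) :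
    HasDerivAt (fun w => diskMoebius a (w * diskMoebius b w))
      (deriv (diskMoebius a) (w * diskMoebius b w) *
        (diskMoebius b w + w * deriv (diskMoebius b) w)) w := by
  have h1 := (hasDerivAt_diskMoebius hb₀ hb₁ hw).differentiableAt.hasDerivAt
  have h2 := (hasDerivAt_diskMoebius ha₀ ha₁
    (norm_mul_diskMoebius_le_one hb₀ hb₁ hw)).differentiableAt.hasDerivAt
  have h3 : HasDerivAt (fun w => w * diskMoebius b w)
      (diskMoebius b w + w * deriv (diskMoebius b) w) w := by
    refine ((hasDerivAt_id w).mul h1).congr_deriv ?_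
    simp
  exact HasDerivAt.comp (h₂ := diskMoebius a) w h2 h3

theorem differentiableAt_schwarzExtremal (ha₀ : 0 ≤ a) (ha₁ : a ≤ 1) (hb₀ : 0 ≤ b) (hb₁ : b ≤ 1)
    (hw : ‖w‖ ≤ 1) :
    DifferentiableAt ℂ (schwarzExtremal a b) w :=
  differentiableAt_id.mul (hasDerivAt_diskMoebius_mul ha₀ ha₁ hb₀ hb₁ hw).differentiableAt

theorem norm_schwarzExtremal_le (ha₀ : 0 ≤ a) (ha₁ : a ≤ 1) (hb₀ : 0 ≤ b) (hb₁ : b ≤ 1)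
    (hw : ‖w‖ ≤ 1) : ‖schwarzExtremal a b w‖ ≤ ‖w‖ := by
  rw [schwarzExtremal, norm_mul]
  exact mul_le_of_le_one_right (norm_nonneg w)
    (norm_diskMoebius_le_one ha₀ ha₁ (norm_mul_diskMoebius_le_one hb₀ hb₁ hw))

theorem deriv_schwarzExtremal_zero (ha₀ : 0 ≤ a) (ha₁ : a ≤ 1) (hb₀ : 0 ≤ b) (hb₁ : b ≤ 1) :
    deriv (schwarzExtremal a b) 0 = a := by
  have h := (hasDerivAt_id (0 : ℂ)).mul
    (hasDerivAt_diskMoebius_mul ha₀ ha₁ hb₀ hb₁ (w := 0) (by simp))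
  refine (HasDerivAt.deriv h).trans ?_
  simp [diskMoebius_zero]

theorem deriv_deriv_schwarzExtremal_zero (ha₀ : 0 ≤ a) (ha₁ : a ≤ 1) (hb₀ : 0 ≤ b) (hb₁ : b ≤ 1) :
    deriv (deriv (schwarzExtremal a b)) 0 = 2 * ((1 - a ^ 2) * b) := by
  have h : DifferentiableOn ℂ (fun w => diskMoebius a (w * diskMoebius b w)) (Metric.ball 0 1) :=
    fun w hw => (hasDerivAt_diskMoebius_mul ha₀ ha₁ hb₀ hb₁
      (mem_ball_zero_iff.1 hw).le).differentiableAt.differentiableWithinAt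
  refine (deriv_deriv_id_mul_zero h).trans ?_
  rw [(hasDerivAt_diskMoebius_mul ha₀ ha₁ hb₀ hb₁ (by simp)).deriv, zero_mul, zero_mul, add_zero,
    deriv_diskMoebius_zero ha₀ ha₁, diskMoebius_zero]

end SchwarzExtremal

theorem schwarzExtremal_ofReal (a : ℝ) {b r : ℝ} (hb : 0 ≤ b) (hr : 0 ≤ r) :
    schwarzExtremal a b r = (schwarzMajorant a b r : ℂ) := by
  rw [schwarzExtremal, diskMoebius_ofReal b hr, ← Complex.ofReal_mul,
    diskMoebius_ofReal a (mul_nonneg hr (moebius_nonneg hb hr)), ← Complex.ofReal_mul,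
    schwarzMajorant]

theorem laplacian_const_mul_one_sub_norm_sq {n : ℕ} (k : ℝ) (z : Cn n) :
    Laplacian.laplacian (fun z : Cn n => ((k * (1 - ‖z‖ ^ 2) : ℝ) : ℂ)) z
      = ((-(4 * n * k) : ℝ) : ℂ) := by
  have hq : ContDiffAt ℝ 2 (fun x : Cn n => ‖x‖ ^ 2) z := (contDiff_norm_sq ℝ).contDiffAt
  have hc : ContDiffAt ℝ 2 (fun _ : Cn n => (1 : ℝ)) z := contDiffAt_const
  let v : Cn n → ℝ := (fun _ => (1 : ℝ)) - fun x : Cn n => ‖x‖ ^ 2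
  have hv : ContDiffAt ℝ 2 v z := hc.sub hq
  have hkv : ContDiffAt ℝ 2 (k • v) z := hv.const_smul k
  have h1 : Laplacian.laplacian (k • v) z = -(4 * n * k) := by
    rw [InnerProductSpace.laplacian_smul k hv, hc.laplacian_sub hq, laplacian_norm_sq,
      finrank_real_Cn, InnerProductSpace.laplacian_const]
    simp
    ring
  have h2 : (fun z : Cn n => ((k * (1 - ‖z‖ ^ 2) : ℝ) : ℂ)) = Complex.ofRealCLM ∘ (k • v) := by
    ext z; simp [v]
  rw [h2, hkv.laplacian_CLM_comp_left, Function.comp_apply, h1, Complex.ofRealCLM_apply]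

/-- Equality is attained by the extremal function of the second-order Schwarz lemma in the
coordinate `⟪η, z⟫`, perturbed by the radial solution of the Poisson equation with constant
right-hand side `-s`. -/
theorem exists_radialLiminf_eq_hopfBound {n : ℕ} (hn : 1 ≤ n) {η : Cn n}
    (hη : η ∈ Metric.sphere (0 : Cn n) 1) {a b s : ℝ} (ha : a ∈ Set.Icc (0 : ℝ) 1)
    (hb : b ∈ Set.Icc (0 : ℝ) 1) (hab : a = 1 → b = 1) (hs : 0 ≤ s)
    (hpos : 0 < hopfBound n a b s) :
    ∃ φ g f : Cn n → ℂ, IsHolomorphicDatum φ ∧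
      Set.MapsTo φ (Metric.ball 0 1) (Metric.ball 0 1) ∧
      ContinuousOn g (Metric.closedBall 0 1) ∧
      IsPoissonSolution g φ f ∧
      Tendsto (fun r : ℝ => ‖f (r • η)‖) (𝓝[<] (1 : ℝ)) (𝓝 1) ∧
      firstOrder φ η = a ∧ lambdaZero φ η = b ∧ supNormBall g = s ∧
      radialLiminf f η =
        ((hopfBound n (firstOrder φ η) (lambdaZero φ η) (supNormBall g) : ℝ) : EReal) := by
  obtain ⟨ha₀, ha₁⟩ := ha
  obtain ⟨hb₀, hb₁⟩ := hb
  have hη1 : ‖η‖ = 1 := mem_sphere_zero_iff_norm.1 hη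
  have hn0 : (n : ℝ) ≠ 0 := by exact_mod_cast (by omega : n ≠ 0)
  set L : Cn n →L[ℂ] ℂ := innerSL ℂ η with hLdef
  have hLη : ∀ ζ : ℂ, L (ζ • η) = ζ := fun ζ => by
    simp [hLdef, innerSL_apply_apply, inner_self_eq_norm_sq_to_K, hη1]
  have hLle : ∀ z, ‖L z‖ ≤ ‖z‖ := fun z => by
    simpa [hLdef, innerSL_apply_apply, hη1] using norm_inner_le_norm (𝕜 := ℂ) η z
  set φ : Cn n → ℂ := fun z => schwarzExtremal a b (L z) with hφdef
  set p : Cn n → ℂ := fun z => ((s / (4 * n) * (1 - ‖z‖ ^ 2) : ℝ) : ℂ) with hpdef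
  set g : Cn n → ℂ := fun _ => ((-s : ℝ) : ℂ) with hgdef
  have hdiff : ∀ z : Cn n, ‖z‖ ≤ 1 → DifferentiableAt ℂ φ z := fun z hz =>
    (differentiableAt_schwarzExtremal ha₀ ha₁ hb₀ hb₁ ((hLle z).trans hz)).comp z
      L.differentiableAt
  have hnorm : ∀ z : Cn n, ‖z‖ ≤ 1 → ‖φ z‖ ≤ ‖z‖ := fun z hz =>
    (norm_schwarzExtremal_le ha₀ ha₁ hb₀ hb₁ ((hLle z).trans hz)).trans (hLle z)
  have hφ : IsHolomorphicDatum φ :=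
    { holomorphic := fun z hz => (hdiff z (mem_ball_zero_iff.1 hz).le).differentiableWithinAt
      continuousOn := fun z hz =>
        (hdiff z (mem_closedBall_zero_iff.1 hz)).continuousAt.continuousWithinAt
      map_zero := by simp [hφdef, schwarzExtremal]
      norm_le_one := fun z hz => by
        have h1 := mem_sphere_zero_iff_norm.1 hz
        exact (hnorm z h1.le).trans h1.le }
  have hφ2 : ContDiffOn ℂ 2 φ (Metric.ball 0 1) :=
    hφ.holomorphic.contDiffOn_two_complex Metric.isOpen_ball
  have hp2 : ContDiff ℝ 2 p :=
    Complex.ofRealCLM.contDiff.comp (contDiff_const.mul (contDiff_const.sub (contDiff_norm_sq ℝ)))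
  have hf : IsPoissonSolution g φ (φ + p) :=
    { contDiffOn := (hφ2.restrict_scalars ℝ).add hp2.contDiffOn
      continuousOn := hφ.continuousOn.add hp2.continuous.continuousOn
      laplacian_eq := fun z hz => by
        have hφz := hφ2.contDiffAt (Metric.isOpen_ball.mem_nhds hz)
        rw [(hφz.restrict_scalars ℝ).laplacian_add hp2.contDiffAt,
          hφz.laplacian_eq_zero_of_complex, zero_add, hpdef,
          laplacian_const_mul_one_sub_norm_sq, hgdef]
        congr 1
        field_simp
      boundary_eq := fun z hz => by
        simp [hpdef, mem_sphere_zero_iff_norm.1 hz] }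
  have hslice : (fun ζ : ℂ => φ (ζ • η)) = schwarzExtremal a b := by
    ext ζ; simp only [hφdef, hLη]
  have hfirst : firstOrder φ η = a := by
    rw [firstOrder_eq_norm_deriv hφ.holomorphic hη, hslice,
      deriv_schwarzExtremal_zero ha₀ ha₁ hb₀ hb₁, Complex.norm_real, Real.norm_of_nonneg ha₀]
  have hlambda : lambdaZero φ η = b := by
    rw [lambdaZero_eq_deriv_deriv hφ.holomorphic hη, hfirst, hslice,
      deriv_deriv_schwarzExtremal_zero ha₀ ha₁ hb₀ hb₁]
    rcases ha₁.lt_or_eq with h | h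
    · have h1 : 0 < 1 - a ^ 2 := by nlinarith
      rw [if_pos h, show (2 : ℂ) * ((1 - (a : ℂ) ^ 2) * b) = ((2 * (1 - a ^ 2) * b : ℝ) : ℂ) by
        push_cast; ring, Complex.norm_real, Real.norm_of_nonneg (by positivity)]
      field_simp
    · rw [if_neg h.not_lt, hab h]
  have hsup : supNormBall g = s := by
    have : Nonempty (Metric.ball (0 : Cn n) 1) := ⟨⟨0, Metric.mem_ball_self one_pos⟩⟩
    simp only [supNormBall, hgdef, Complex.norm_real, norm_neg, Real.norm_of_nonneg hs, ciSup_const]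
  have hradial : ∀ r : ℝ, 0 ≤ r → (φ + p) (r • η) =
      ((schwarzMajorant a b r + s / (4 * n) * (1 - r ^ 2) : ℝ) : ℂ) := by
    intro r hr
    have h1 : φ (r • η) = (schwarzMajorant a b r : ℂ) := by
      rw [← schwarzExtremal_ofReal a hb₀ hr, ← Complex.coe_smul]
      exact congrFun hslice r
    simp only [Pi.add_apply, h1, hpdef, norm_smul, hη1, mul_one, Real.norm_of_nonneg hr]
    push_cast
    rfl
  have hfη : (φ + p) η = 1 := by
    have := hradial 1 zero_le_one
    rw [schwarzMajorant_one ha₀ hb₀] at this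
    simpa using this
  refine ⟨φ, g, φ + p, hφ, fun z hz => ?_, continuousOn_const, hf, ?_, hfirst, hlambda, hsup, ?_⟩
  · rw [mem_ball_zero_iff] at hz ⊢
    exact (hnorm z hz.le).trans_lt hz
  · have h1 : ContinuousAt (fun r : ℝ => (φ + p) (r • η)) 1 := by
      refine ContinuousAt.comp (g := φ + p) (f := fun r : ℝ => r • η) ?_ (by fun_prop)
      rw [one_smul]
      exact (hdiff η hη1.le).continuousAt.add hp2.continuous.continuousAt
    have h2 := h1.norm.tendsto.mono_left (nhdsWithin_le_nhds (s := Set.Iio 1))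
    simpa only [one_smul, hfη, norm_one] using h2
  · rw [hfirst, hlambda, hsup, radialLiminf]
    have h1 := (tendsto_hopfBound n ha₀ hb₀ s).abs
    rw [abs_of_pos hpos] at h1
    refine Tendsto.liminf_eq ((continuous_coe_real_ereal.tendsto _).comp (h1.congr' ?_))
    have hIoo : ∀ᶠ r : ℝ in 𝓝[<] 1, r ∈ Set.Ioo (0 : ℝ) 1 := Ioo_mem_nhdsLT one_pos
    filter_upwards [hIoo] with r hr
    rw [hfη, hradial r hr.1.le, ← Complex.ofReal_one, ← Complex.ofReal_sub, Complex.norm_real,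
      Real.norm_eq_abs, abs_div, abs_of_pos (sub_pos.2 hr.2), sub_add_eq_sub_sub]

theorem mainTheorem4 (n : ℕ) (hn : 1 ≤ n) :
    (∀ φ g f : Cn n → ℂ, IsHolomorphicDatum φ → ContinuousOn g (Metric.closedBall 0 1) →
      IsPoissonSolution g φ f →
      ∀ η ∈ Metric.sphere (0 : Cn n) 1,
        Tendsto (fun r : ℝ => ‖f (r • η)‖) (𝓝[<] (1 : ℝ)) (𝓝 1) →
        ((hopfBound n (firstOrder φ η) (lambdaZero φ η) (supNormBall g) : ℝ) : EReal)
          ≤ radialLiminf f η) ∧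
    (∀ η ∈ Metric.sphere (0 : Cn n) 1, ∀ a ∈ Set.Icc (0 : ℝ) 1, ∀ b ∈ Set.Icc (0 : ℝ) 1,
      (a = 1 → b = 1) → ∀ s : ℝ, 0 ≤ s → 0 < hopfBound n a b s →
      ∃ φ g f : Cn n → ℂ, IsHolomorphicDatum φ ∧
        Set.MapsTo φ (Metric.ball 0 1) (Metric.ball 0 1) ∧
        ContinuousOn g (Metric.closedBall 0 1) ∧
        IsPoissonSolution g φ f ∧
        Tendsto (fun r : ℝ => ‖f (r • η)‖) (𝓝[<] (1 : ℝ)) (𝓝 1) ∧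
        firstOrder φ η = a ∧ lambdaZero φ η = b ∧ supNormBall g = s ∧
        radialLiminf f η =
          ((hopfBound n (firstOrder φ η) (lambdaZero φ η) (supNormBall g) : ℝ) : EReal)) :=
  ⟨fun _ _ _ hφ hg hf _ hη hlim => hopfBound_le_radialLiminf hn hφ hg hf hη hlim,
    fun _ hη _ ha _ hb hab _ hs hpos =>
      exists_radialLiminf_eq_hopfBound hn hη ha hb hab hs hpos⟩
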